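/- There is an absolute constant $C>0$ such that for every prime $p$ and every integer $a\not\equiv 0 \pmod p$, Heilbronn's exponential sum $$S(a)=\sum_{n=1}^{p} e^{2\pi i\, a n^p/p^2}$$ satisfies $$|S(a)|\le C\, p^{5/6}\,(\log p)^{1/6}.$$ -/

import Mathlib

/-- Heilbronn's exponential sum `S(a) = ∑_{n=1}^p e^{2πi · a n^p / p²}`. -/
noncomputable def heilbronnSum (p : ℕ) (a : ℤ) : ℂ :=
  ∑ n ∈ Finset.Icc 1 p,
    Complex.exp (2 * (Real.pi : ℂ) * Complex.I * (((a : ℂ) * (n : ℂ) ^ p) / (p : ℂ) ^ 2))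

/-! The residue `n ^ p` mod `p ^ 2` depends only on `n` mod `p`, so up to the term `n = p` the sum
is a character sum `S` over a multiplicative group `H` of units of `ZMod (p ^ 2)`. Write `N d` for
`diffCount H d`.

Fourier side (`norm_charSum_pow_six_le`): the positive semidefinite matrix with entries `dilateSum ψ
H (x - y)`, for `x, y ∈ H`, has `‖S‖ ^ 2` as an eigenvalue, with constant eigenvector, so `‖S‖ ^ 6`
is at most the trace of its cube. Cauchy–Schwarz and orthogonality bound that trace by `p ^ 2 * ∑ N
d ^ 3`.

Reduction to level sets: invariance under `H` gives `∑ N d ^ 3 = |H| * ∑ N (y - 1) ^ 2`, and for `y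
≠ 1` in `H`, `N (y - 1)` is at most the size of a fibre of `q = ((X + 1) ^ p - X ^ p - 1) / p` mod
`p` (`diffCount_primePowers_sub_one_le`).

Stepanov's method (`card_level_sets_mul_le`): near `-1`, `q` imitates a logarithm, so the products
`X ^ a * q ^ b * (X + 1) ^ (p * c)` are independent; some nonzero combination vanishes to high order
on the chosen fibres and its degree bounds their total size. Hence `O(p ^ 2 / k ^ 3)` fibres have at
least `k` points, so the cubes of the fibre sizes sum to `O(p ^ 2 * log p)`. Altogether `‖S‖ ^ 6` is
`O(p ^ 2 * p * p ^ 2 * log p)`. -/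

/-- The number of representations of `d` as a difference of two elements of `H`. -/
noncomputable def diffCount {R : Type*} [CommRing R] (H : Finset R) (d : R) : ℕ :=
  open Classical in (H.filter (fun x => x - d ∈ H)).card

/-- The sum of an additive character over the dilate of `H` by `d`. -/
noncomputable def dilateSum {R : Type*} [CommRing R] (ψ : AddChar R ℂ) (H : Finset R) (d : R) : ℂ :=
  ∑ h ∈ H, ψ (h * d)

/-! ### Sixth power of a character sum versus the third moment of differences -/

section FourierMoment

variable {R : Type*} [CommRing R]

theorem sum_mul_left_of_mul_closed (H : Finset R) (hmul : ∀ x ∈ H, ∀ y ∈ H, x * y ∈ H)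
    (hunit : ∀ x ∈ H, IsUnit x) {M : Type*} [AddCommMonoid M] {h : R} (hh : h ∈ H) (F : R → M) :
    ∑ x ∈ H, F (h * x) = ∑ x ∈ H, F x := by
  classical
  have hinj : Set.InjOn (fun x => h * x) (H : Set R) :=
    fun x _ y _ hxy => (hunit h hh).mul_left_cancel hxy
  have himg : H.image (fun x => h * x) = H := by
    apply Finset.eq_of_subset_of_card_le
    · intro x hx
      obtain ⟨y, hy, rfl⟩ := Finset.mem_image.1 hx
      exact hmul h hh y hy
    · rw [Finset.card_image_of_injOn hinj]
  conv_rhs => rw [← himg]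
  rw [Finset.sum_image hinj]

theorem diffCount_def (H : Finset R) (d : R) [DecidablePred fun x => x - d ∈ H] :
    diffCount H d = (H.filter fun x => x - d ∈ H).card := by
  unfold diffCount
  congr

theorem diffCount_eq_sum [Fintype R] [DecidableEq R] (H : Finset R) (d : R) :
    (diffCount H d : ℝ) = ∑ x, (if x ∈ H then (1 : ℝ) else 0) * (if x - d ∈ H then 1 else 0) := by
  simp_rw [ite_mul, one_mul, zero_mul, Finset.sum_ite_mem, Finset.univ_inter]
  simp only [diffCount_def, Finset.card_filter, Nat.cast_sum, Nat.cast_ite, Nat.cast_one, Nat.cast_zero]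

theorem sum_indicator_add [Fintype R] [DecidableEq R] (H : Finset R) (y z : R) :
    ∑ u, (if y + u ∈ H then (1 : ℝ) else 0) * (if z + u ∈ H then 1 else 0)
      = diffCount H (y - z) := by
  rw [diffCount_eq_sum]
  apply Fintype.sum_equiv (Equiv.addLeft y)
  intro u
  rw [Equiv.coe_addLeft, show y + u - (y - z) = z + u by ring]

theorem sum_indicator_sub [Fintype R] [DecidableEq R] (H : Finset R) (y z : R) :
    ∑ u, (if y - u ∈ H then (1 : ℝ) else 0) * (if z - u ∈ H then 1 else 0)
      = diffCount H (y - z) := by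
  rw [diffCount_eq_sum]
  apply Fintype.sum_equiv (Equiv.subLeft y)
  intro u
  rw [Equiv.subLeft_apply, show y - u - (y - z) = z - u by ring]

theorem diffCount_neg [Finite R] (H : Finset R) (d : R) : diffCount H (-d) = diffCount H d := by
  classical
  have := Fintype.ofFinite R
  have h1 := sum_indicator_add H 0 d
  have h2 := sum_indicator_add H d 0
  rw [zero_sub] at h1
  rw [sub_zero] at h2
  have : (diffCount H (-d) : ℝ) = diffCount H d := by
    rw [← h1, ← h2]
    exact Finset.sum_congr rfl fun u _ => mul_comm _ _
  exact_mod_cast this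

theorem sum_sub_eq_sum_indicator [Fintype R] [DecidableEq R] (H : Finset R) (y : R) (F : R → ℂ) :
    ∑ x ∈ H, F (x - y) = ∑ u, ((if y + u ∈ H then (1 : ℝ) else 0 : ℝ) : ℂ) * F u := by
  refine ((Fintype.sum_equiv (Equiv.addLeft y) _
    (fun x => ((if x ∈ H then (1 : ℝ) else 0 : ℝ) : ℂ) * F (x - y)) fun u => ?_).trans ?_).symm
  · rw [Equiv.coe_addLeft, add_sub_cancel_left]
  · simp_rw [apply_ite Complex.ofReal, Complex.ofReal_one, Complex.ofReal_zero, ite_mul, one_mul,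
      zero_mul, Finset.sum_ite_mem, Finset.univ_inter]

theorem sum_sub_eq_sum_indicator' [Fintype R] [DecidableEq R] (H : Finset R) (y : R) (F : R → ℂ) :
    ∑ x ∈ H, F (y - x) = ∑ u, ((if y - u ∈ H then (1 : ℝ) else 0 : ℝ) : ℂ) * F u := by
  refine ((Fintype.sum_equiv (Equiv.subLeft y) _
    (fun x => ((if x ∈ H then (1 : ℝ) else 0 : ℝ) : ℂ) * F (y - x)) fun u => ?_).trans ?_).symm
  · rw [Equiv.subLeft_apply, sub_sub_cancel]
  · simp_rw [apply_ite Complex.ofReal, Complex.ofReal_one, Complex.ofReal_zero, ite_mul, one_mul,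
      zero_mul, Finset.sum_ite_mem, Finset.univ_inter]

theorem sum_sum_sub_eq_sum_diffCount [Fintype R] (H : Finset R) (F : R → ℂ) :
    ∑ x ∈ H, ∑ y ∈ H, F (x - y) = ∑ d, (diffCount H d : ℂ) * F d := by
  classical
  rw [Finset.sum_comm]
  simp_rw [sum_sub_eq_sum_indicator H _ F]
  rw [Finset.sum_comm]
  refine Finset.sum_congr rfl fun d _ => ?_
  rw [← Finset.sum_mul]
  congr 1
  rw [← diffCount_neg, ← Complex.ofReal_natCast, diffCount_eq_sum, Complex.ofReal_sum]
  simp_rw [ite_mul, one_mul, zero_mul, sub_neg_eq_add, apply_ite Complex.ofReal,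
    Complex.ofReal_zero, Finset.sum_ite_mem, Finset.univ_inter]

theorem conj_dilateSum [Finite R] (ψ : AddChar R ℂ) (H : Finset R) (d : R) :
    (starRingEnd ℂ) (dilateSum ψ H d) = dilateSum ψ H (-d) := by
  simp only [dilateSum, map_sum]
  refine Finset.sum_congr rfl fun h _ => ?_
  rw [mul_neg, AddChar.map_neg_eq_conj]

theorem norm_dilateSum_sq [Fintype R] (ψ : AddChar R ℂ) (H : Finset R) (u : R) :
    ((‖dilateSum ψ H u‖ ^ 2 : ℝ) : ℂ) = ∑ d, (diffCount H d : ℂ) * ψ (u * d) := by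
  rw [← sum_sum_sub_eq_sum_diffCount H (fun d => ψ (u * d))]
  push_cast
  rw [← Complex.mul_conj', conj_dilateSum, dilateSum, dilateSum, Finset.sum_mul_sum]
  refine Finset.sum_congr rfl fun x _ => Finset.sum_congr rfl fun y _ => ?_
  rw [← AddChar.map_add_eq_mul]
  congr 1
  ring

/-- Each squared norm is the Fourier transform of `diffCount H`. Summing over `u` and `v` forces `a
= b = -c` among the three frequencies, and `diffCount H` is even. -/
theorem sum_norm_dilateSum_six [Fintype R] (ψ : AddChar R ℂ) (hψ : ψ.IsPrimitive)
    (H : Finset R) :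
    ∑ u, ∑ v, ‖dilateSum ψ H u‖ ^ 2 * ‖dilateSum ψ H v‖ ^ 2 * ‖dilateSum ψ H (u + v)‖ ^ 2
      = (Fintype.card R : ℝ) ^ 2 * ∑ d : R, (diffCount H d : ℝ) ^ 3 := by
  classical
  apply Complex.ofReal_injective
  have horth : ∀ b : R, ∑ x, ψ (x * b) = if b = 0 then (Fintype.card R : ℂ) else 0 := by
    intro b
    rw [AddChar.sum_mulShift b hψ]
    split_ifs <;> simp
  have key : ∀ u v : R,
      ((‖dilateSum ψ H u‖ ^ 2 * ‖dilateSum ψ H v‖ ^ 2 * ‖dilateSum ψ H (u + v)‖ ^ 2 : ℝ) : ℂ)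
      = ∑ c, ∑ a, ∑ b, (diffCount H a : ℂ) * diffCount H b * diffCount H c
          * (ψ (u * (a + c)) * ψ (v * (b + c))) := by
    intro u v
    rw [Complex.ofReal_mul, Complex.ofReal_mul, norm_dilateSum_sq, norm_dilateSum_sq,
      norm_dilateSum_sq, Finset.sum_mul_sum, mul_comm, Finset.sum_mul]
    refine Finset.sum_congr rfl fun c _ => ?_
    rw [Finset.mul_sum]
    refine Finset.sum_congr rfl fun a _ => ?_
    rw [Finset.mul_sum]
    refine Finset.sum_congr rfl fun b _ => ?_
    rw [mul_add, mul_add, add_mul, AddChar.map_add_eq_mul, AddChar.map_add_eq_mul,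
      AddChar.map_add_eq_mul]
    ring
  have e1 : ∀ a c : R, (a + c = 0) = (a = -c) := fun a c => propext eq_neg_iff_add_eq_zero.symm
  rw [Complex.ofReal_sum]
  simp_rw [Complex.ofReal_sum, key]
  calc _ = ∑ c, ∑ a, ∑ b, (diffCount H a : ℂ) * diffCount H b * diffCount H c
          * ((∑ u, ψ (u * (a + c))) * ∑ v, ψ (v * (b + c))) := by
        simp_rw [Finset.sum_mul_sum, Finset.mul_sum]
        have : ∀ u : R, ∑ v, ∑ c, ∑ a, ∑ b, (diffCount H a : ℂ) * diffCount H b * diffCount H c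
            * (ψ (u * (a + c)) * ψ (v * (b + c)))
            = ∑ c, ∑ a, ∑ b, ∑ v, (diffCount H a : ℂ) * diffCount H b * diffCount H c
            * (ψ (u * (a + c)) * ψ (v * (b + c))) := by
          intro u
          rw [Finset.sum_comm]
          refine Finset.sum_congr rfl fun c _ => ?_
          rw [Finset.sum_comm]
          refine Finset.sum_congr rfl fun a _ => ?_
          rw [Finset.sum_comm]
        simp_rw [this]
        rw [Finset.sum_comm]
        refine Finset.sum_congr rfl fun c _ => ?_
        rw [Finset.sum_comm]
        refine Finset.sum_congr rfl fun a _ => ?_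
        rw [Finset.sum_comm]
    _ = ∑ c, (Fintype.card R : ℂ) ^ 2 * (diffCount H c : ℂ) ^ 3 := by
        refine Finset.sum_congr rfl fun c _ => ?_
        simp_rw [horth, e1]
        simp only [mul_ite, ite_mul, zero_mul, mul_zero, Finset.sum_ite_eq', Finset.mem_univ,
          if_true]
        rw [diffCount_neg]
        ring
    _ = _ := by
        push_cast
        rw [Finset.mul_sum]

theorem sum_diffCount_cube [Fintype R] (H : Finset R) :
    ∑ d : R, (diffCount H d : ℝ) ^ 3 = ∑ y ∈ H, ∑ z ∈ H, (diffCount H (y - z) : ℝ) ^ 2 := by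
  apply Complex.ofReal_injective
  have := sum_sum_sub_eq_sum_diffCount H (fun d => (diffCount H d : ℂ) ^ 2)
  push_cast
  rw [this]
  exact Finset.sum_congr rfl fun d _ => by ring

/-- Expanding the square over pairs `y, z ∈ H` separates `u` from `v`; each of the two sums is
`diffCount H (y - z)`. -/
theorem sum_triple_count_sq [Fintype R] [DecidableEq R] (H : Finset R) :
    ∑ u : R, ∑ v : R, (∑ y ∈ H, (if y + u ∈ H then (1 : ℝ) else 0)
      * (if y - v ∈ H then 1 else 0)) ^ 2 = ∑ d : R, (diffCount H d : ℝ) ^ 3 := by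
  rw [sum_diffCount_cube]
  simp_rw [sq, Finset.sum_mul_sum]
  calc _ = ∑ y ∈ H, ∑ z ∈ H, ∑ u : R, ∑ v : R,
        ((if y + u ∈ H then (1 : ℝ) else 0) * (if z + u ∈ H then 1 else 0))
        * ((if y - v ∈ H then (1 : ℝ) else 0) * (if z - v ∈ H then 1 else 0)) := by
        have : ∀ u : R, ∑ v : R, ∑ y ∈ H, ∑ z ∈ H,
            ((if y + u ∈ H then (1 : ℝ) else 0) * (if y - v ∈ H then 1 else 0))
            * ((if z + u ∈ H then (1 : ℝ) else 0) * (if z - v ∈ H then 1 else 0))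
            = ∑ y ∈ H, ∑ z ∈ H, ∑ v : R,
            ((if y + u ∈ H then (1 : ℝ) else 0) * (if z + u ∈ H then 1 else 0))
            * ((if y - v ∈ H then (1 : ℝ) else 0) * (if z - v ∈ H then 1 else 0)) := by
          intro u
          rw [Finset.sum_comm]
          refine Finset.sum_congr rfl fun y _ => ?_
          rw [Finset.sum_comm]
          refine Finset.sum_congr rfl fun z _ => Finset.sum_congr rfl fun v _ => by ring
        simp_rw [this]
        rw [Finset.sum_comm]
        refine Finset.sum_congr rfl fun y _ => ?_
        rw [Finset.sum_comm]
    _ = _ := by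
        refine Finset.sum_congr rfl fun y _ => Finset.sum_congr rfl fun z _ => ?_
        rw [← Finset.sum_mul_sum, sum_indicator_add, sum_indicator_sub]

theorem sum_dilateSum_sub (ψ : AddChar R ℂ) [Finite R] (H : Finset R)
    (hmul : ∀ x ∈ H, ∀ y ∈ H, x * y ∈ H) (hunit : ∀ x ∈ H, IsUnit x) {y : R} (hy : y ∈ H) :
    ∑ x ∈ H, dilateSum ψ H (x - y) = (‖∑ h ∈ H, ψ h‖ ^ 2 : ℝ) := by
  simp only [dilateSum]
  rw [Finset.sum_comm]
  have : ∀ h ∈ H, ∑ x ∈ H, ψ (h * (x - y)) = ψ (-(y * h)) * ∑ x ∈ H, ψ x := by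
    intro h hh
    rw [← sum_mul_left_of_mul_closed H hmul hunit hh (fun x => ψ x), Finset.mul_sum]
    refine Finset.sum_congr rfl fun x _ => ?_
    rw [← AddChar.map_add_eq_mul]
    congr 1
    ring
  rw [Finset.sum_congr rfl this, ← Finset.sum_mul,
    sum_mul_left_of_mul_closed H hmul hunit hy (fun x => ψ (-x))]
  simp_rw [AddChar.map_neg_eq_conj]
  rw [← map_sum, mul_comm, Complex.mul_conj']
  push_cast
  rfl

/-- With `W = (ψ (x * h))` and `M = W W*`, which has entries `dilateSum ψ H (x - y)`, the right side
is `tr M ^ 3`, the squared Frobenius norm of `V = M W`. Every column of `V` sums to `‖S‖ ^ 2 * S`,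
so Cauchy–Schwarz in each column gives the bound without spectral theory. -/
theorem norm_charSum_pow_six_le_trace [Finite R] (ψ : AddChar R ℂ) (H : Finset R)
    (hmul : ∀ x ∈ H, ∀ y ∈ H, x * y ∈ H) (hunit : ∀ x ∈ H, IsUnit x) :
    ‖∑ h ∈ H, ψ h‖ ^ 6 ≤ ‖∑ x ∈ H, ∑ y ∈ H, ∑ z ∈ H,
      dilateSum ψ H (x - y) * dilateSum ψ H (y - z) * dilateSum ψ H (z - x)‖ := by
  rcases H.eq_empty_or_nonempty with rfl | hne
  · simp
  set S : ℂ := ∑ h ∈ H, ψ h with hS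
  set g := dilateSum ψ H with hg
  set V : R → R → ℂ := fun h x => ∑ y ∈ H, ψ (h * y) * g (x - y) with hV
  have htrace : ∑ x ∈ H, ∑ y ∈ H, ∑ z ∈ H, g (x - y) * g (y - z) * g (z - x)
      = ((∑ h ∈ H, ∑ x ∈ H, ‖V h x‖ ^ 2 : ℝ) : ℂ) := by
    push_cast
    rw [Finset.sum_comm (s := H) (t := H) (f := fun h x => ((‖V h x‖ : ℂ)) ^ 2)]
    refine Finset.sum_congr rfl fun x _ => ?_
    have hexp : ∀ h, ((‖V h x‖ : ℂ)) ^ 2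
        = ∑ y ∈ H, ∑ z ∈ H, g (x - y) * ψ (h * (y - z)) * g (z - x) := by
      intro h
      rw [← Complex.mul_conj', hV]
      simp only [map_sum, map_mul]
      rw [Finset.sum_mul_sum]
      refine Finset.sum_congr rfl fun y _ => Finset.sum_congr rfl fun z _ => ?_
      rw [hg, conj_dilateSum, neg_sub, ← AddChar.map_neg_eq_conj,
        show h * (y - z) = h * y + -(h * z) by ring, AddChar.map_add_eq_mul]
      ring
    simp_rw [hexp]
    rw [Finset.sum_comm (s := H) (t := H)
      (f := fun h y => ∑ z ∈ H, g (x - y) * ψ (h * (y - z)) * g (z - x))]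
    refine Finset.sum_congr rfl fun y _ => ?_
    rw [Finset.sum_comm]
    refine Finset.sum_congr rfl fun z _ => ?_
    rw [← Finset.sum_mul, ← Finset.mul_sum]
    rfl
  have hrow : ∀ h ∈ H, ‖S‖ ^ 6 ≤ (H.card : ℝ) * ∑ x ∈ H, ‖V h x‖ ^ 2 := by
    intro h hh
    have hsum : ∑ x ∈ H, V h x = (‖S‖ ^ 2 : ℝ) * S := by
      simp only [hV]
      rw [Finset.sum_comm]
      have : ∀ y ∈ H, ∑ x ∈ H, ψ (h * y) * g (x - y) = ψ (h * y) * (‖S‖ ^ 2 : ℝ) := by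
        intro y hy
        rw [← Finset.mul_sum, hg, sum_dilateSum_sub ψ H hmul hunit hy]
      rw [Finset.sum_congr rfl this, ← Finset.sum_mul,
        sum_mul_left_of_mul_closed H hmul hunit hh (fun x => ψ x), mul_comm]
    have h3 : ‖S‖ ^ 3 ≤ ∑ x ∈ H, ‖V h x‖ := by
      have := norm_sum_le H (V h)
      rw [hsum, norm_mul, Complex.norm_real, Real.norm_of_nonneg (by positivity)] at this
      calc ‖S‖ ^ 3 = ‖S‖ ^ 2 * ‖S‖ := by ring
        _ ≤ _ := this
    calc ‖S‖ ^ 6 = (‖S‖ ^ 3) ^ 2 := by ring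
      _ ≤ (∑ x ∈ H, ‖V h x‖) ^ 2 := by gcongr
      _ ≤ _ := sq_sum_le_card_mul_sum_sq
  have htot : (H.card : ℝ) * ‖S‖ ^ 6 ≤ (H.card : ℝ) * ∑ h ∈ H, ∑ x ∈ H, ‖V h x‖ ^ 2 := by
    rw [Finset.mul_sum]
    calc _ = ∑ h ∈ H, ‖S‖ ^ 6 := by simp
      _ ≤ _ := Finset.sum_le_sum hrow
  rw [htrace, Complex.norm_real, Real.norm_of_nonneg (by positivity)]
  exact le_of_mul_le_mul_left htot (by exact_mod_cast hne.card_pos)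

/-- The sixth power of a character sum over a multiplicatively closed set of units is controlled by
the third moment of its difference representation function. -/
theorem norm_charSum_pow_six_le [Fintype R] (ψ : AddChar R ℂ) (hψ : ψ.IsPrimitive) (H : Finset R)
    (hmul : ∀ x ∈ H, ∀ y ∈ H, x * y ∈ H) (hunit : ∀ x ∈ H, IsUnit x) :
    ‖∑ h ∈ H, ψ h‖ ^ 6 ≤ Fintype.card R * ∑ d : R, (diffCount H d : ℝ) ^ 3 := by
  classical
  refine (norm_charSum_pow_six_le_trace ψ H hmul hunit).trans ?_
  set g := dilateSum ψ H with hg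
  set E : ℝ := ∑ d : R, (diffCount H d : ℝ) ^ 3 with hE
  have hE0 : 0 ≤ E := by positivity
  -- Substituting `u = x - y`, `v = y - z`: `K u v` counts the triples in `H` with these
  -- differences. Cauchy–Schwarz then separates `K` from the dilate sums.
  set K : R → R → ℝ := fun u v => ∑ y ∈ H, (if y + u ∈ H then (1 : ℝ) else 0)
      * (if y - v ∈ H then 1 else 0) with hK
  have hK0 : ∀ u v, 0 ≤ K u v := fun u v => by
    simp only [hK]
    exact Finset.sum_nonneg fun y _ => by positivity
  have hrep : ∑ x ∈ H, ∑ y ∈ H, ∑ z ∈ H, g (x - y) * g (y - z) * g (z - x)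
      = ∑ u, ∑ v, (K u v : ℂ) * (g u * g v * g (-(u + v))) := by
    rw [Finset.sum_comm]
    have h1 : ∀ y ∈ H, ∑ x ∈ H, ∑ z ∈ H, g (x - y) * g (y - z) * g (z - x)
        = ∑ u, ∑ v, (((if y + u ∈ H then (1 : ℝ) else 0) * (if y - v ∈ H then 1 else 0) : ℝ) : ℂ)
          * (g u * g v * g (-(u + v))) := by
      intro y _
      have h2 : ∀ x, ∑ z ∈ H, g (x - y) * g (y - z) * g (z - x)
          = ∑ v, ((if y - v ∈ H then (1 : ℝ) else 0 : ℝ) : ℂ)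
            * (g (x - y) * g v * g (-((x - y) + v))) := by
        intro x
        rw [← sum_sub_eq_sum_indicator' H y (fun v => g (x - y) * g v * g (-((x - y) + v)))]
        refine Finset.sum_congr rfl fun z _ => ?_
        rw [show -(x - y + (y - z)) = z - x by ring]
      simp_rw [h2]
      rw [sum_sub_eq_sum_indicator H y (fun u => ∑ v, ((if y - v ∈ H then (1 : ℝ) else 0 : ℝ) : ℂ)
            * (g u * g v * g (-(u + v))))]
      refine Finset.sum_congr rfl fun u _ => ?_
      rw [Finset.mul_sum]
      refine Finset.sum_congr rfl fun v _ => ?_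
      push_cast
      ring
    rw [Finset.sum_congr rfl h1, Finset.sum_comm]
    refine Finset.sum_congr rfl fun u _ => ?_
    rw [Finset.sum_comm]
    refine Finset.sum_congr rfl fun v _ => ?_
    rw [← Finset.sum_mul, ← Complex.ofReal_sum]
  have hnorm : ∀ u, ‖g (-u)‖ = ‖g u‖ := fun u => by
    rw [hg, ← conj_dilateSum, RCLike.norm_conj]
  have hbound : ‖∑ u, ∑ v, (K u v : ℂ) * (g u * g v * g (-(u + v)))‖
      ≤ ∑ w : R × R, K w.1 w.2 * (‖g w.1‖ * ‖g w.2‖ * ‖g (w.1 + w.2)‖) := by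
    rw [Fintype.sum_prod_type]
    refine (norm_sum_le _ _).trans (Finset.sum_le_sum fun u _ => ?_)
    refine (norm_sum_le _ _).trans (Finset.sum_le_sum fun v _ => ?_)
    rw [norm_mul, norm_mul, norm_mul, hnorm, Complex.norm_real, Real.norm_of_nonneg (hK0 u v)]
  rw [hrep]
  refine hbound.trans (abs_le_of_sq_le_sq' ?_ (by positivity)).2
  refine (Finset.sum_mul_sq_le_sq_mul_sq _ _ _).trans ?_
  have hA : ∑ w : R × R, K w.1 w.2 ^ 2 = E := by
    rw [Fintype.sum_prod_type]
    exact sum_triple_count_sq H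
  have hB : ∑ w : R × R, (‖g w.1‖ * ‖g w.2‖ * ‖g (w.1 + w.2)‖) ^ 2
      = (Fintype.card R : ℝ) ^ 2 * E := by
    rw [Fintype.sum_prod_type, ← sum_norm_dilateSum_six ψ hψ H]
    exact Finset.sum_congr rfl fun u _ => Finset.sum_congr rfl fun v _ => by ring
  rw [hA, hB]
  exact le_of_eq (by ring)

end FourierMoment

/-! ### Stepanov's method for the level sets of `q` -/

section Stepanov

open Polynomial

variable {p : ℕ} [Fact p.Prime]

/-- Modulo `(X + 1) ^ (p - 1)` this reads `q' = 1 / X`: the logarithmic behaviour at `-1`. -/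
theorem X_mul_derivative_of_derivative_eq {q : (ZMod p)[X]}
    (hq : derivative q = (X + 1) ^ (p - 1) - X ^ (p - 1)) :
    X * derivative q = 1 - (X + 1) ^ (p - 1) := by
  have hp : p - 1 + 1 = p := Nat.sub_add_cancel (Fact.out : p.Prime).one_le
  have h1 : (X : (ZMod p)[X]) * X ^ (p - 1) = X ^ p := by rw [← pow_succ', hp]
  have h2 : ((X : (ZMod p)[X]) + 1) * (X + 1) ^ (p - 1) = (X + 1) ^ p := by rw [← pow_succ', hp]
  have h3 : ((X : (ZMod p)[X]) + 1) ^ p = X ^ p + 1 := by rw [add_pow_char, one_pow]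
  rw [hq]
  linear_combination -h1 + h2 + h3

theorem natDegree_X_mul_derivative_le {K : Type*} [Field K] (F : K[X]) :
    (X * derivative F).natDegree ≤ F.natDegree := by
  rw [natDegree_le_iff_coeff_eq_zero]
  intro i hi
  rcases i with _ | i
  · simp
  · rw [coeff_X_mul, coeff_derivative, coeff_eq_zero_of_natDegree_lt hi, zero_mul]

theorem coeff_X_mul_derivative {K : Type*} [Field K] (F : K[X]) (i : ℕ) :
    (X * derivative F).coeff i = i * F.coeff i := by
  rcases i with _ | i
  · simp
  · rw [coeff_X_mul, coeff_derivative]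
    push_cast
    ring

theorem natDegree_X_add_one_pow {K : Type*} [Field K] (m : ℕ) :
    ((X + 1 : K[X]) ^ m).natDegree = m := by
  rw [← C_1, natDegree_pow, natDegree_X_add_C, mul_one]

/-- A polynomial in `X` and `q` which is not zero cannot vanish to high order at `-1`, provided
that `q` behaves like a logarithm there. -/
theorem not_X_add_one_pow_dvd_sum {q : (ZMod p)[X]}
    (hq : X * derivative q = 1 - (X + 1) ^ (p - 1)) (A m : ℕ) :
    ∀ (β : ℕ) (F : ℕ → (ZMod p)[X]), β < p → β * A + (F β).natDegree = m → m + 1 ≤ p →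
      (∀ b ≤ β, (F b).natDegree < A) → F β ≠ 0 →
      ¬ (X + 1) ^ (m + 1) ∣ ∑ b ∈ Finset.range (β + 1), F b * q ^ b := by
  induction m using Nat.strong_induction_on with
  | _ m ih =>
  intro β F hβ hm hmp hA hF hdvd
  rcases β with _ | β
  · simp only [zero_add, Finset.range_one, Finset.sum_singleton, pow_zero, mul_one] at hdvd
    have := natDegree_le_of_dvd hdvd hF
    rw [natDegree_X_add_one_pow] at this
    omega
  set α := (F (β + 1)).natDegree with hα
  -- Coefficients after applying `X d/dX - α`, with `X * q'` replaced by `1`. The error is a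
  -- multiple of `(X + 1) ^ (p - 1)`, so only one order of vanishing is lost, while the weight `β *
  -- A + deg F β` drops.
  set F' : ℕ → (ZMod p)[X] := fun b => X * derivative (F b) - C (α : ZMod p) * F b
    + if b < β + 1 then ((b + 1 : ℕ) : (ZMod p)[X]) * F (b + 1) else 0 with hF'
  have hderiv : X * derivative (∑ b ∈ Finset.range (β + 2), F b * q ^ b)
      - C (α : ZMod p) * ∑ b ∈ Finset.range (β + 2), F b * q ^ b
      + (X + 1) ^ (p - 1) * ∑ b ∈ Finset.range (β + 2), (b : (ZMod p)[X]) * F b * q ^ (b - 1)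
      = ∑ b ∈ Finset.range (β + 2), F' b * q ^ b := by
    have hshift : ∑ b ∈ Finset.range (β + 2),
        (if b < β + 1 then ((b + 1 : ℕ) : (ZMod p)[X]) * F (b + 1) else 0) * q ^ b
        = ∑ b ∈ Finset.range (β + 2), (b : (ZMod p)[X]) * F b * q ^ (b - 1) := by
      conv_lhs => rw [Finset.sum_range_succ]
      conv_rhs => rw [Finset.sum_range_succ']
      simp only [lt_irrefl, if_false, zero_mul, add_zero, Nat.cast_zero]
      refine Finset.sum_congr rfl fun b hb => ?_
      rw [if_pos (Finset.mem_range.1 hb), Nat.add_sub_cancel]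
    simp only [hF', add_mul, Finset.sum_add_distrib]
    rw [hshift, derivative_sum, Finset.mul_sum, Finset.mul_sum, Finset.mul_sum,
      ← Finset.sum_sub_distrib, ← Finset.sum_add_distrib, ← Finset.sum_add_distrib]
    refine Finset.sum_congr rfl fun b _ => ?_
    rw [derivative_mul, derivative_pow]
    simp only [map_natCast]
    linear_combination (b : (ZMod p)[X]) * F b * q ^ (b - 1) * hq
  have hdvd' : (X + 1) ^ m ∣ ∑ b ∈ Finset.range (β + 2), F' b * q ^ b := by
    rw [← hderiv]
    refine dvd_add (dvd_sub (Dvd.dvd.mul_left ?_ _) (Dvd.dvd.mul_left ?_ _))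
      (Dvd.dvd.mul_right (pow_dvd_pow _ (by omega)) _)
    · obtain ⟨r, hr⟩ := hdvd
      rw [hr, derivative_mul, derivative_pow, Nat.add_sub_cancel]
      exact dvd_add (Dvd.dvd.mul_right (Dvd.dvd.mul_right (Dvd.intro_left _ rfl) _) _)
        (Dvd.dvd.mul_right (pow_dvd_pow _ (Nat.le_succ m)) _)
    · exact (pow_dvd_pow _ (Nat.le_succ m)).trans hdvd
  have hbase : ∀ b ≤ β + 1, (X * derivative (F b) - C (α : ZMod p) * F b).natDegree < A :=
    fun b hb => lt_of_le_of_lt ((natDegree_sub_le _ _).trans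
      (max_le (natDegree_X_mul_derivative_le _) (natDegree_C_mul_le _ _))) (hA b hb)
  have hA' : ∀ b ≤ β + 1, (F' b).natDegree < A := by
    intro b hb
    refine lt_of_le_of_lt (natDegree_add_le _ _) (max_lt (hbase b hb) ?_)
    split_ifs with h
    · rw [← C_eq_natCast]
      exact lt_of_le_of_lt (natDegree_C_mul_le _ _) (hA (b + 1) (by omega))
    · rw [natDegree_zero]
      have := hA b hb
      omega
  have htop : F' (β + 1) = X * derivative (F (β + 1)) - C (α : ZMod p) * F (β + 1) := by
    simp [hF']
  -- `X d/dX - α` kills the leading term of `F (β + 1)`. If nothing is left, the degree in `q`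
  -- drops, and `F' β` is nonzero: its coefficient at `X ^ α` is `β + 1`, invertible mod `p`, times
  -- that leading coefficient.
  by_cases h0 : F' (β + 1) = 0
  · rw [Finset.sum_range_succ, h0, zero_mul, add_zero] at hdvd'
    have hne : F' β ≠ 0 := by
      intro h
      have h1 := congrArg (fun P => coeff P α) h
      simp only [hF', coeff_add, coeff_sub, coeff_X_mul_derivative, coeff_C_mul, sub_self,
        zero_add, coeff_zero, lt_add_iff_pos_right, zero_lt_one, if_true] at h1
      rw [← C_eq_natCast, coeff_C_mul, mul_eq_zero] at h1
      rcases h1 with h1 | h1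
      · rw [ZMod.natCast_eq_zero_iff] at h1
        exact absurd (Nat.le_of_dvd (Nat.succ_pos _) h1) (by omega)
      · exact hF (leadingCoeff_eq_zero.1 h1)
    have hdeg := hA' β (Nat.le_succ _)
    have hlt : β * A + (F' β).natDegree < m := by
      rw [← hm, add_mul]
      omega
    exact ih _ hlt β F' (by omega) rfl (by omega) (fun b hb => hA' b (by omega)) hne
      ((pow_dvd_pow _ hlt).trans hdvd')
  · have hle : (F' (β + 1)).natDegree ≤ α := by
      rw [htop]
      exact (natDegree_sub_le _ _).trans
        (max_le (natDegree_X_mul_derivative_le _) (natDegree_C_mul_le _ _))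
    have hlt : (F' (β + 1)).natDegree < α := by
      refine lt_of_le_of_ne hle fun h => h0 ?_
      rw [← leadingCoeff_eq_zero, leadingCoeff, h, htop, coeff_sub, coeff_X_mul_derivative,
        coeff_C_mul, sub_self]
    have hlt' : (β + 1) * A + (F' (β + 1)).natDegree < m := by omega
    exact ih _ hlt' (β + 1) F' hβ rfl (by omega) hA' h0 ((pow_dvd_pow _ hlt').trans hdvd')

theorem eq_zero_of_X_add_one_pow_dvd_sum {q : (ZMod p)[X]}
    (hq : X * derivative q = 1 - (X + 1) ^ (p - 1)) {A : ℕ} (F : ℕ → (ZMod p)[X]) (B : ℕ)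
    (hA : ∀ b < B, (F b).natDegree < A) (hAB : A * B ≤ p)
    (hdvd : (X + 1) ^ p ∣ ∑ b ∈ Finset.range B, F b * q ^ b) : ∀ b < B, F b = 0 := by
  induction B with
  | zero => intro b hb; omega
  | succ B ih =>
    have hAB' : B * A + A ≤ p := by rw [mul_comm, add_mul] at hAB; omega
    have hdeg := hA B (Nat.lt_succ_self B)
    have hB : F B = 0 := by
      by_contra h
      have hBA : B ≤ B * A := Nat.le_mul_of_pos_right B (by omega)
      exact not_X_add_one_pow_dvd_sum hq A _ B F (by omega) rfl (by omega)
        (fun b hb => hA b (by omega)) h ((pow_dvd_pow _ (by omega)).trans hdvd)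
    rw [Finset.sum_range_succ, hB, zero_mul, add_zero] at hdvd
    intro b hb
    rcases Nat.lt_succ_iff_lt_or_eq.1 hb with h | rfl
    · exact ih (fun b hb => hA b (by omega)) (by rw [mul_comm]; omega) hdvd b h
    · exact hB

/-- Digit extraction in base `Z`: the lowest digit is divisible by `Z`, hence zero; then cancel one
factor `Z` and repeat. -/
theorem eq_zero_of_sum_pow_mul_eq_zero {R : Type*} [CommRing R] [IsDomain R] {Z : R} (hZ : Z ≠ 0) :
    ∀ (C : ℕ) (G : Fin C → R), (∀ c, Z ∣ G c → G c = 0) → ∑ c : Fin C, Z ^ (c : ℕ) * G c = 0 →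
      ∀ c, G c = 0 := by
  intro C
  induction C with
  | zero => intro G _ _ c; exact c.elim0
  | succ C ih =>
    intro G hG hsum
    rw [Fin.sum_univ_succ] at hsum
    have hfac : ∑ i : Fin C, Z ^ ((i.succ : Fin (C + 1)) : ℕ) * G i.succ
        = Z * ∑ i : Fin C, Z ^ (i : ℕ) * G i.succ := by
      rw [Finset.mul_sum]
      refine Finset.sum_congr rfl fun i _ => ?_
      rw [Fin.val_succ, pow_succ]
      ring
    rw [hfac, Fin.val_zero, pow_zero, one_mul] at hsum
    have h0 : G 0 = 0 := hG 0 ⟨-∑ i : Fin C, Z ^ (i : ℕ) * G i.succ, by linear_combination hsum⟩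
    rw [h0, zero_add] at hsum
    intro c
    refine Fin.cases h0 (fun i => ?_) c
    exact ih (fun i => G i.succ) (fun i => hG i.succ) ((mul_eq_zero.1 hsum).resolve_left hZ) i

/-- The products `X ^ a * q ^ b * (X + 1) ^ (p * c)`. -/
noncomputable def stepanovMonomial (q : (ZMod p)[X]) (a b c : ℕ) : (ZMod p)[X] :=
  X ^ a * q ^ b * ((X + 1) ^ p) ^ c

theorem linearIndependent_stepanovMonomial {q : (ZMod p)[X]}
    (hq : X * derivative q = 1 - (X + 1) ^ (p - 1)) {A B C : ℕ} (hAB : A * B ≤ p) :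
    LinearIndependent (ZMod p)
      (fun i : Fin A × Fin B × Fin C => stepanovMonomial q i.1 i.2.1 i.2.2) := by
  rw [Fintype.linearIndependent_iff]
  intro g hg
  set F : Fin C → ℕ → (ZMod p)[X] := fun c b => if h : b < B then
    ∑ a : Fin A, Polynomial.C (g (a, ⟨b, h⟩, c)) * X ^ (a : ℕ) else 0 with hF
  have hG : ∑ c : Fin C, ((X + 1 : (ZMod p)[X]) ^ p) ^ (c : ℕ)
      * ∑ b ∈ Finset.range B, F c b * q ^ b = 0 := by
    rw [← hg, Fintype.sum_prod_type_right, Fintype.sum_prod_type_right]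
    refine Finset.sum_congr rfl fun c _ => ?_
    rw [Finset.sum_range, Finset.mul_sum]
    refine Finset.sum_congr rfl fun b _ => ?_
    simp only [hF, b.2, dif_pos, Finset.sum_mul, Finset.mul_sum]
    refine Finset.sum_congr rfl fun a _ => ?_
    rw [stepanovMonomial, smul_eq_C_mul]
    ring
  have hX : (X + 1 : (ZMod p)[X]) ≠ 0 := by
    rw [← Polynomial.C_1]
    exact X_add_C_ne_zero _
  have hzero : ∀ c, ∀ b < B, (X + 1 : (ZMod p)[X]) ^ p ∣ ∑ b ∈ Finset.range B, F c b * q ^ b →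
      F c b = 0 := by
    intro c b hb hdvd
    rcases Nat.eq_zero_or_pos A with rfl | hApos
    · simp [hF]
    refine eq_zero_of_X_add_one_pow_dvd_sum hq (F c) B ?_ hAB hdvd b hb
    intro b hb
    simp only [hF, hb, dif_pos]
    by_cases h0 : ∑ a : Fin A, Polynomial.C (g (a, ⟨b, hb⟩, c)) * X ^ (a : ℕ) = 0
    · rw [h0, natDegree_zero]
      exact hApos
    · exact (natDegree_lt_iff_degree_lt h0).2 (degree_sum_fin_lt _)
  have hall := eq_zero_of_sum_pow_mul_eq_zero (pow_ne_zero p hX) C _ (fun c hdvd =>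
    Finset.sum_eq_zero fun b hb => by rw [hzero c b (Finset.mem_range.1 hb) hdvd, zero_mul]) hG
  rintro ⟨a, b, c⟩
  have h1 := hzero c b b.2 (by rw [hall c]; exact dvd_zero _)
  simp only [hF, b.2, dif_pos] at h1
  have h2 := congrArg (fun P => coeff P (a : ℕ)) h1
  simpa [finsetSum_coeff, coeff_X_pow, Fin.val_inj] using h2

theorem natDegree_stepanovMonomial_le {q : (ZMod p)[X]} (hdeg : q.natDegree ≤ p) (a b c : ℕ) :
    (stepanovMonomial q a b c).natDegree ≤ a + p * (b + c) := by
  rw [stepanovMonomial]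
  refine natDegree_mul_le.trans ?_
  rw [← pow_mul, natDegree_X_add_one_pow, mul_add, ← add_assoc]
  gcongr
  refine natDegree_mul_le.trans ?_
  rw [natDegree_X_pow, mul_comm p b]
  gcongr
  exact natDegree_pow_le.trans (by gcongr)

/-- The derivation `X (X + 1) d/dX`. -/
noncomputable def weightedDerivative (p : ℕ) : (ZMod p)[X] →ₗ[ZMod p] (ZMod p)[X] :=
  LinearMap.mulLeft (ZMod p) (X * (X + 1)) ∘ₗ derivative

theorem weightedDerivative_apply (F : (ZMod p)[X]) :
    weightedDerivative p F = X * (X + 1) * derivative F := rfl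

/-- The span of the products `X ^ a * q ^ b * (X + 1) ^ (p * c)` with `a + c ≤ m`. -/
noncomputable def stepanovSpan (q : (ZMod p)[X]) (m : ℕ) : Submodule (ZMod p) (ZMod p)[X] :=
  Submodule.span (ZMod p) {G | ∃ a b c, a + c ≤ m ∧ G = stepanovMonomial q a b c}

theorem stepanovMonomial_mem (q : (ZMod p)[X]) {a b c m : ℕ} (h : a + c ≤ m) :
    stepanovMonomial q a b c ∈ stepanovSpan q m :=
  Submodule.subset_span ⟨a, b, c, h, rfl⟩

/-- The factor `X` clears the denominator of `q'`, the factor `X + 1` completes `(X + 1) ^ (p - 1)`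
to a `p`-th power, and `p`-th powers have zero derivative. So each application raises `a + c` by at
most one. -/
theorem weightedDerivative_stepanovMonomial {q : (ZMod p)[X]}
    (hq : X * derivative q = 1 - (X + 1) ^ (p - 1)) (a b c : ℕ) :
    weightedDerivative p (stepanovMonomial q a b c)
      = (a : ZMod p) • (stepanovMonomial q (a + 1) b c + stepanovMonomial q a b c)
      + (b : ZMod p) • (stepanovMonomial q (a + 1) (b - 1) c + stepanovMonomial q a (b - 1) c
        - stepanovMonomial q a (b - 1) (c + 1)) := by
  have hp : p - 1 + 1 = p := Nat.sub_add_cancel (Fact.out : p.Prime).one_le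
  have h2 : ((X : (ZMod p)[X]) + 1) * (X + 1) ^ (p - 1) = (X + 1) ^ p := by rw [← pow_succ', hp]
  have ha : (a : (ZMod p)[X]) * X ^ (a - 1) * X = (a : (ZMod p)[X]) * X ^ a := by
    rcases a with _ | a
    · simp
    · rw [Nat.add_sub_cancel, pow_succ]
      ring
  have hZ : derivative (((X + 1 : (ZMod p)[X]) ^ p) ^ c) = 0 := by
    rw [derivative_pow, derivative_pow]
    simp
  simp only [weightedDerivative_apply, stepanovMonomial, derivative_mul, hZ, smul_eq_C_mul,
    derivative_pow (p := q), derivative_X_pow, map_natCast]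
  rw [← h2]
  generalize ((X + 1 : (ZMod p)[X]) ^ (p - 1)) = W at *
  linear_combination (X + 1) * q ^ b * ((X + 1) * W) ^ c * ha
    + (X + 1) * X ^ a * b * q ^ (b - 1) * ((X + 1) * W) ^ c * hq

theorem weightedDerivative_mem {q : (ZMod p)[X]}
    (hq : X * derivative q = 1 - (X + 1) ^ (p - 1)) {m : ℕ} {G : (ZMod p)[X]}
    (hG : G ∈ stepanovSpan q m) : weightedDerivative p G ∈ stepanovSpan q (m + 1) := by
  have : stepanovSpan q m ≤ (stepanovSpan q (m + 1)).comap (weightedDerivative p) := by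
    rw [stepanovSpan, Submodule.span_le]
    rintro _ ⟨a, b, c, h, rfl⟩
    rw [SetLike.mem_coe, Submodule.mem_comap, weightedDerivative_stepanovMonomial hq]
    refine add_mem (Submodule.smul_mem _ _ (add_mem ?_ ?_))
      (Submodule.smul_mem _ _ (sub_mem (add_mem ?_ ?_) ?_)) <;>
    exact stepanovMonomial_mem q (by omega)
  exact this hG

theorem weightedDerivative_pow_mem {q : (ZMod p)[X]}
    (hq : X * derivative q = 1 - (X + 1) ^ (p - 1)) {m : ℕ} {G : (ZMod p)[X]}
    (hG : G ∈ stepanovSpan q m) (n : ℕ) :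
    (weightedDerivative p ^ n) G ∈ stepanovSpan q (m + n) := by
  induction n with
  | zero => simpa using hG
  | succ n ih =>
    rw [pow_succ', Module.End.mul_apply]
    exact weightedDerivative_mem hq ih

/-- Evaluation on the level set `q = u`. -/
noncomputable def evalLevelSet (q : (ZMod p)[X]) (u : ZMod p) :
    (ZMod p)[X] →ₗ[ZMod p] (ZMod p → ZMod p) :=
  LinearMap.pi fun x => if q.eval x = u then leval x else 0

theorem evalLevelSet_apply (q : (ZMod p)[X]) (u x : ZMod p) (G : (ZMod p)[X]) :
    evalLevelSet q u G x = if q.eval x = u then G.eval x else 0 := by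
  simp only [evalLevelSet, LinearMap.pi_apply]
  split_ifs <;> rfl

/-- At a point of `ZMod p` with `q = u`, `q ^ b` is the constant `u ^ b` and `(X + 1) ^ p` equals `X
+ 1`. The degree falls to `a + c`, which makes vanishing cheap to impose. -/
theorem evalLevelSet_mem (q : (ZMod p)[X]) (u : ZMod p) {m M : ℕ} (hM : m < M) {G : (ZMod p)[X]}
    (hG : G ∈ stepanovSpan q m) :
    evalLevelSet q u G ∈ (degreeLT (ZMod p) M).map (evalLevelSet q u) := by
  have : stepanovSpan q m ≤
      ((degreeLT (ZMod p) M).map (evalLevelSet q u)).comap (evalLevelSet q u) := by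
    rw [stepanovSpan, Submodule.span_le]
    rintro _ ⟨a, b, c, h, rfl⟩
    rw [SetLike.mem_coe, Submodule.mem_comap]
    refine ⟨X ^ a * Polynomial.C (u ^ b) * (X + 1) ^ c, ?_, ?_⟩
    · rw [SetLike.mem_coe, mem_degreeLT]
      refine lt_of_le_of_lt degree_le_natDegree ?_
      have h1 : (X ^ a * Polynomial.C (u ^ b) * (X + 1) ^ c : (ZMod p)[X]).natDegree ≤ a + c := by
        refine natDegree_mul_le.trans ?_
        rw [natDegree_X_add_one_pow]
        gcongr
        exact (natDegree_mul_C_le _ _).trans (natDegree_X_pow_le a)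
      exact_mod_cast lt_of_le_of_lt (h1.trans h) hM
    · ext x
      rw [evalLevelSet_apply, evalLevelSet_apply]
      split_ifs with hx
      · simp [stepanovMonomial, hx, ZMod.pow_card]
      · rfl
  exact this hG

/-- Away from `0` and `-1` the factor `X * (X + 1)` is coprime to `X - x`, so ordinary derivatives
may be used; the multiplicities met in the induction are below `p`, hence invertible. -/
theorem X_sub_C_pow_dvd_of_weightedDerivative {x : ZMod p} (hx0 : x ≠ 0) (hx1 : x + 1 ≠ 0)
    {D : ℕ} (hD : D ≤ p) : ∀ G : (ZMod p)[X],
    (∀ n < D, ((weightedDerivative p ^ n) G).eval x = 0) → (X - C x) ^ D ∣ G := by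
  induction D with
  | zero => intro G _; simp
  | succ D ih =>
    intro G hG
    obtain ⟨r, hr⟩ := ih (by omega) G (fun n hn => hG n (by omega))
    rcases Nat.eq_zero_or_pos D with rfl | hDpos
    · rw [zero_add, pow_one, dvd_iff_isRoot]
      exact hG 0 Nat.zero_lt_one
    have hG' : (X - C x) ^ D ∣ X * (X + 1) * derivative G := by
      refine ih (by omega) _ fun n hn => ?_
      have := hG (n + 1) (by omega)
      rwa [pow_succ, Module.End.mul_apply, weightedDerivative_apply] at this
    have hcop : IsCoprime ((X - C x : (ZMod p)[X]) ^ D) (X * (X + 1)) := by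
      refine IsCoprime.pow_left ((irreducible_X_sub_C x).coprime_iff_not_dvd.2 ?_)
      rw [dvd_iff_isRoot, IsRoot.def]
      simp [hx0, hx1]
    have hG'' := hcop.dvd_of_dvd_mul_left hG'
    have hexp : derivative G = (X - C x) ^ (D - 1) * (C (D : ZMod p) * r
        + (X - C x) * derivative r) := by
      conv_lhs => rw [hr, derivative_mul, derivative_X_sub_C_pow]
      conv_lhs => rw [← Nat.sub_add_cancel hDpos, pow_succ]
      rw [Nat.add_sub_cancel, Nat.sub_add_cancel hDpos, C_eq_natCast]
      ring
    rw [hexp] at hG''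
    conv_lhs at hG'' => rw [← Nat.sub_add_cancel hDpos, pow_succ]
    have h1 := (mul_dvd_mul_iff_left (pow_ne_zero _ (X_sub_C_ne_zero x))).1 hG''
    have h2 : (X - C x) ∣ C (D : ZMod p) * r := (dvd_add_left (Dvd.intro _ rfl)).1 h1
    have hDne : (D : ZMod p) ≠ 0 := by
      rw [Ne, ZMod.natCast_eq_zero_iff]
      intro h
      exact absurd (Nat.le_of_dvd hDpos h) (by omega)
    have h3 : (X - C x) ∣ r := by
      rw [dvd_iff_isRoot, IsRoot.def, eval_mul, eval_C, mul_eq_zero] at h2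
      exact dvd_iff_isRoot.2 (h2.resolve_left hDne)
    rw [hr, pow_succ]
    exact mul_dvd_mul_left _ h3

/-- The Stepanov bound for the number of points where `q` takes values in a given set. -/
theorem card_level_sets_mul_le {q : (ZMod p)[X]}
    (hq : X * derivative q = 1 - (X + 1) ^ (p - 1)) (hdeg : q.natDegree ≤ p)
    {A B C D : ℕ} (hAB : A * B ≤ p) (hD : D ≤ p) (U : Finset (ZMod p))
    (hcount : U.card * (D * (A + C + D)) < A * B * C) :
    (Finset.univ.filter fun x : ZMod p => x ≠ 0 ∧ x + 1 ≠ 0 ∧ q.eval x ∈ U).card * D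
      ≤ A + p * (B + C) := by
  set ι := Fin A × Fin B × Fin C
  set mon : ι → (ZMod p)[X] := fun i => stepanovMonomial q i.1 i.2.1 i.2.2 with hmon
  have hind : LinearIndependent (ZMod p) mon := linearIndependent_stepanovMonomial hq hAB
  set Φ : (ι → ZMod p) →ₗ[ZMod p] (ZMod p)[X] := Fintype.linearCombination (ZMod p) mon with hΦ
  have hΦmem : ∀ v, Φ v ∈ stepanovSpan q (A + C) := by
    intro v
    rw [hΦ, Fintype.linearCombination_apply]
    exact sum_mem fun i _ => Submodule.smul_mem _ _ (stepanovMonomial_mem q (by omega))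
  have hΦdeg : ∀ v, (Φ v).natDegree ≤ A + p * (B + C) := by
    intro v
    rw [hΦ, Fintype.linearCombination_apply]
    refine natDegree_sum_le_of_forall_le _ _ fun i _ => ?_
    refine (natDegree_smul_le _ _).trans ((natDegree_stepanovMonomial_le hdeg _ _ _).trans ?_)
    gcongr
    · exact i.1.2.le
    · exact i.2.1.2.le
    · exact i.2.2.2.le
  set E : Fin D × U → Submodule (ZMod p) (ZMod p → ZMod p) := fun j =>
    (degreeLT (ZMod p) (A + C + D)).map (evalLevelSet q j.2) with hE
  -- The vanishing conditions: one for each derivative order below `D` and each value in `U`. By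
  -- `hcount` the target has dimension below `A * B * C`, so the kernel is nontrivial.
  set T : (ι → ZMod p) →ₗ[ZMod p] ((j : Fin D × U) → E j) := LinearMap.pi fun j =>
    LinearMap.codRestrict (E j) (evalLevelSet q j.2 ∘ₗ (weightedDerivative p ^ (j.1 : ℕ)) ∘ₗ Φ)
      (fun v => evalLevelSet_mem q _ (by omega)
        (weightedDerivative_pow_mem hq (hΦmem v) (j.1 : ℕ))) with hT
  have hEfin : ∀ j, Module.finrank (ZMod p) (E j) ≤ A + C + D := by
    intro j
    have h := (degreeLTEquiv (ZMod p) (A + C + D)).finrank_eq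
    rw [Module.finrank_fin_fun] at h
    have : Module.Finite (ZMod p) (degreeLT (ZMod p) (A + C + D)) :=
      Module.Finite.equiv (degreeLTEquiv (ZMod p) (A + C + D)).symm
    calc _ ≤ Module.finrank (ZMod p) (degreeLT (ZMod p) (A + C + D)) :=
          Submodule.finrank_map_le _ _
      _ = _ := h
  have hker : LinearMap.ker T ≠ ⊥ := by
    apply LinearMap.ker_ne_bot_of_finrank_lt
    rw [Module.finrank_pi_fintype, Module.finrank_fintype_fun_eq_card]
    calc _ ≤ ∑ _j : Fin D × U, (A + C + D) := Finset.sum_le_sum fun j _ => hEfin j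
      _ = U.card * (D * (A + C + D)) := by
        simp
        ring
      _ < A * B * C := hcount
      _ = Fintype.card ι := by simp [ι, mul_assoc]
  obtain ⟨v, hv, hv0⟩ := (Submodule.ne_bot_iff _).1 hker
  have hΨ0 : Φ v ≠ 0 := by
    intro h
    apply hv0
    rw [hΦ, Fintype.linearCombination_apply] at h
    exact funext (Fintype.linearIndependent_iff.1 hind v h)
  have hvanish : ∀ x ∈ (Finset.univ.filter fun x : ZMod p =>
      x ≠ 0 ∧ x + 1 ≠ 0 ∧ q.eval x ∈ U), (X - Polynomial.C x) ^ D ∣ Φ v := by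
    intro x hx
    obtain ⟨-, hx0, hx1, hxU⟩ := Finset.mem_filter.1 hx
    refine X_sub_C_pow_dvd_of_weightedDerivative hx0 hx1 hD _ fun n hn => ?_
    have h1 := congrFun (LinearMap.mem_ker.1 hv) (⟨n, hn⟩, ⟨q.eval x, hxU⟩)
    have h2 := congrFun (congrArg Subtype.val h1) x
    change evalLevelSet q (q.eval x) ((weightedDerivative p ^ n) (Φ v)) x = 0 at h2
    rwa [evalLevelSet_apply, if_pos rfl] at h2
  have hprod := Finset.prod_dvd_of_coprime (fun x _ y _ hxy =>
    ((pairwise_coprime_X_sub_C (s := fun x : ZMod p => x) Function.injective_id hxy).pow :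
      IsCoprime ((X - Polynomial.C x : (ZMod p)[X]) ^ D) ((X - Polynomial.C y) ^ D))) hvanish
  have hle := natDegree_le_of_dvd hprod hΨ0
  rw [natDegree_prod _ _ fun x _ => pow_ne_zero _ (X_sub_C_ne_zero x)] at hle
  simp only [natDegree_pow, natDegree_X_sub_C, mul_one, Finset.sum_const, smul_eq_mul] at hle
  exact hle.trans (hΦdeg v)

end Stepanov

/-! ### From Stepanov's bound to the third moment of fibre sizes -/

section LevelSets

open Polynomial

variable {p : ℕ} [Fact p.Prime]

/-- The number of `x ≠ 0, -1` with `q x = u`. -/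
noncomputable def levelCount (q : (ZMod p)[X]) (u : ZMod p) : ℕ :=
  (Finset.univ.filter fun x : ZMod p => x ≠ 0 ∧ x + 1 ≠ 0 ∧ q.eval x = u).card

theorem sum_levelCount (q : (ZMod p)[X]) (U : Finset (ZMod p)) :
    ∑ u ∈ U, levelCount q u
      = (Finset.univ.filter fun x : ZMod p => x ≠ 0 ∧ x + 1 ≠ 0 ∧ q.eval x ∈ U).card := by
  rw [Finset.card_eq_sum_card_fiberwise (f := fun x => q.eval x) (t := U)]
  · refine Finset.sum_congr rfl fun u hu => ?_
    rw [levelCount, Finset.filter_filter]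
    congr 1
    ext x
    simp only [Finset.mem_filter, Finset.mem_univ, true_and]
    constructor
    · rintro ⟨h0, h1, rfl⟩
      exact ⟨⟨h0, h1, hu⟩, rfl⟩
    · rintro ⟨⟨h0, h1, -⟩, h⟩
      exact ⟨h0, h1, h⟩
  · intro x hx
    exact (Finset.mem_filter.1 hx).2.2.2

theorem sum_levelCount_le (q : (ZMod p)[X]) (U : Finset (ZMod p)) :
    ∑ u ∈ U, levelCount q u ≤ p := by
  rw [sum_levelCount]
  exact (Finset.card_le_univ _).trans_eq (ZMod.card p)

theorem levelCount_le (q : (ZMod p)[X]) (u : ZMod p) : levelCount q u ≤ p :=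
  (Finset.card_le_univ _).trans_eq (ZMod.card p)

theorem exists_cube_between (n : ℕ) (hn : 1 ≤ n) : ∃ B : ℕ, n ≤ B ^ 3 ∧ B ^ 3 ≤ 8 * n := by
  have hex : ∃ B : ℕ, n ≤ B ^ 3 := ⟨n, Nat.le_self_pow (by norm_num) n⟩
  refine ⟨Nat.find hex, Nat.find_spec hex, ?_⟩
  rcases h : Nat.find hex with _ | b
  · simp
  · have hlt : b ^ 3 < n := not_le.1 (Nat.find_min hex (by omega))
    rcases Nat.eq_zero_or_pos b with rfl | hb
    · omega
    · calc (b + 1) ^ 3 ≤ (2 * b) ^ 3 := Nat.pow_le_pow_left (by omega) 3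
        _ = 8 * b ^ 3 := by ring
        _ ≤ 8 * n := by omega

theorem card_levelCount_ge_mul_cube_le {q : (ZMod p)[X]}
    (hq : X * derivative q = 1 - (X + 1) ^ (p - 1)) (hdeg : q.natDegree ≤ p) (k : ℕ) :
    (Finset.univ.filter fun u : ZMod p => k ≤ levelCount q u).card * k ^ 3
      ≤ 2048000 * p ^ 2 := by
  have hp1 : 1 ≤ p := (Fact.out : p.Prime).one_le
  set U := Finset.univ.filter fun u : ZMod p => k ≤ levelCount q u with hU
  set J := U.card with hJ
  have hsum : J * k ≤ ∑ u ∈ U, levelCount q u := by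
    rw [hJ, ← smul_eq_mul]
    exact Finset.card_nsmul_le_sum _ _ _ fun u hu => (Finset.mem_filter.1 hu).2
  have hJk : J * k ≤ p := hsum.trans (sum_levelCount_le q U)
  rcases Nat.eq_zero_or_pos J with hJ0 | hJpos
  · rw [hJ0, zero_mul]
    exact Nat.zero_le _
  have hkp : k ≤ p := (Nat.le_mul_of_pos_left k hJpos).trans hJk
  by_cases hsmall : p ≤ 100
  · calc J * k ^ 3 = (J * k) * k ^ 2 := by ring
      _ ≤ p * p ^ 2 := by gcongr
      _ ≤ 2048000 * p ^ 2 := by gcongr; omega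
  -- For many fibres the trivial bound `J * k ≤ p` suffices, since `J * k ^ 3 = (J * k) ^ 3 / J ^
  -- 2`.
  by_cases hlarge : p ≤ J ^ 2
  · have h1 : J * k ^ 3 * p ≤ p ^ 2 * p := by
      calc J * k ^ 3 * p ≤ J * k ^ 3 * J ^ 2 := by gcongr
        _ = (J * k) ^ 3 := by ring
        _ ≤ p ^ 3 := by gcongr
        _ = p ^ 2 * p := by ring
    have h2 := Nat.le_of_mul_le_mul_right h1 hp1
    omega
  push Not at hsmall hlarge
  -- Stepanov parameters: `C = B` and `D = A = p / B`, with `B ^ 3` of order `p * J` so that there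
  -- are more unknowns than conditions. The outcome `J * k ≤ 5 * B ^ 2`, cubed, gives the constant
  -- `125 * 128 ^ 2 = 2048000`.
  obtain ⟨B, hB1, hB2⟩ := exists_cube_between (16 * p * J)
    (Nat.mul_pos (Nat.mul_pos (by norm_num) hp1) hJpos)
  have hBpos : 0 < B := by
    rcases Nat.eq_zero_or_pos B with rfl | h
    · have := Nat.mul_pos hp1 hJpos
      nlinarith
    · exact h
  have hB6 : B ^ 6 ≤ 16384 * p ^ 2 * J ^ 2 := by
    calc B ^ 6 = (B ^ 3) ^ 2 := by ring
      _ ≤ (8 * (16 * p * J)) ^ 2 := by gcongr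
      _ = _ := by ring
  have hBp : B ≤ p := by
    by_contra h
    push Not at h
    have h1 : p ^ 3 * p ^ 3 < 16384 * p ^ 3 := by
      calc p ^ 3 * p ^ 3 = p ^ 6 := by ring
        _ < B ^ 6 := Nat.pow_lt_pow_left h (by norm_num)
        _ ≤ 16384 * p ^ 2 * J ^ 2 := hB6
        _ ≤ 16384 * p ^ 2 * p := by gcongr
        _ = _ := by ring
    have h2 := lt_of_mul_lt_mul_right h1 (Nat.zero_le _)
    have h3 : 100 ^ 3 < p ^ 3 := Nat.pow_lt_pow_left hsmall (by norm_num)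
    omega
  set A := p / B with hA
  have hAB : A * B ≤ p := Nat.div_mul_le_self p B
  have hApos : 0 < A := Nat.div_pos hBp hBpos
  have hpAB : p ≤ 2 * A * B := by
    have h1 : p < (A + 1) * B := by
      rw [mul_comm]
      exact Nat.lt_mul_div_succ p hBpos
    have h2 : 1 * B ≤ A * B := Nat.mul_le_mul_right _ hApos
    linarith
  have hJB : 2 * J ≤ B := by
    have h1 : (2 * J) ^ 3 ≤ B ^ 3 := by
      calc (2 * J) ^ 3 = 8 * (J ^ 2 * J) := by ring
        _ ≤ 8 * (p * J) := by gcongr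
        _ ≤ 16 * p * J := by nlinarith [Nat.zero_le (p * J)]
        _ ≤ B ^ 3 := hB1
    exact le_of_pow_le_pow_left₀ (by norm_num) (Nat.zero_le _) h1
  have hcount : J * (A * (A + B + A)) < A * B * B := by
    have h1 : J * (2 * A + B) < B * B := by
      have h2 : B * (J * (2 * A + B)) < B * (B * B) := by
        have h3 : 2 * J * (A * B) ≤ 2 * J * p := Nat.mul_le_mul_left _ hAB
        have h4 : 2 * J * (B * B) ≤ B * (B * B) := Nat.mul_le_mul_right _ hJB
        have h5 : 0 < B ^ 3 := by positivity
        nlinarith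
      exact lt_of_mul_lt_mul_left h2 (Nat.zero_le _)
    calc J * (A * (A + B + A)) = A * (J * (2 * A + B)) := by ring
      _ < A * (B * B) := Nat.mul_lt_mul_of_pos_left h1 hApos
      _ = _ := by ring
  have hmain := card_level_sets_mul_le hq hdeg hAB ((Nat.div_le_self p B)) U hcount
  rw [← sum_levelCount] at hmain
  have hJk2 : J * k ≤ 5 * B ^ 2 := by
    have h1 : A * (J * k) ≤ A * (5 * B ^ 2) := by
      calc A * (J * k) ≤ (∑ u ∈ U, levelCount q u) * A := by
            rw [mul_comm]
            gcongr
        _ ≤ A + p * (B + B) := hmain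
        _ ≤ A + 2 * A * B * (B + B) := by gcongr
        _ = A * 1 + A * (4 * B ^ 2) := by ring
        _ ≤ A * B ^ 2 + A * (4 * B ^ 2) := by
            gcongr
            exact Nat.one_le_pow _ _ hBpos
        _ = _ := by ring
    exact Nat.le_of_mul_le_mul_left h1 hApos
  have hfin : J ^ 2 * (J * k ^ 3) ≤ J ^ 2 * (2048000 * p ^ 2) := by
    calc J ^ 2 * (J * k ^ 3) = (J * k) ^ 3 := by ring
      _ ≤ (5 * B ^ 2) ^ 3 := by gcongr
      _ = 125 * B ^ 6 := by ring
      _ ≤ 125 * (16384 * p ^ 2 * J ^ 2) := by gcongr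
      _ = _ := by ring
  exact Nat.le_of_mul_le_mul_left hfin (by positivity)

theorem cube_le_sum_sq (n : ℕ) : n ^ 3 ≤ ∑ k ∈ Finset.Icc 1 n, 3 * k ^ 2 := by
  induction n with
  | zero => simp
  | succ n ih =>
    rw [Finset.sum_Icc_succ_top (by omega)]
    have : (n + 1) ^ 3 + (3 * n + 2) = n ^ 3 + 3 * (n + 1) ^ 2 := by ring
    omega

/-- Layer-cake summation: level `k` contributes at most `3 * 2048000 * p ^ 2 / k`, and the harmonic
sum produces the logarithm. -/
theorem sum_levelCount_cube_le {q : (ZMod p)[X]}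
    (hq : X * derivative q = 1 - (X + 1) ^ (p - 1)) (hdeg : q.natDegree ≤ p) :
    ∑ u, (levelCount q u : ℝ) ^ 3 ≤ 6144000 * (p : ℝ) ^ 2 * (1 + Real.log p) := by
  have h1 : ∀ u, levelCount q u ^ 3
      ≤ ∑ k ∈ Finset.Icc 1 p, if k ≤ levelCount q u then 3 * k ^ 2 else 0 := by
    intro u
    refine (cube_le_sum_sq _).trans ?_
    rw [← Finset.sum_filter]
    refine Finset.sum_le_sum_of_subset fun k hk => ?_
    have := levelCount_le q u
    simp only [Finset.mem_Icc, Finset.mem_filter] at hk ⊢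
    omega
  have h2 : ∑ u, levelCount q u ^ 3 ≤ ∑ k ∈ Finset.Icc 1 p,
      (Finset.univ.filter fun u : ZMod p => k ≤ levelCount q u).card * (3 * k ^ 2) := by
    refine (Finset.sum_le_sum fun u _ => h1 u).trans_eq ?_
    rw [Finset.sum_comm]
    refine Finset.sum_congr rfl fun k _ => ?_
    rw [← Finset.sum_filter, Finset.sum_const, smul_eq_mul]
  have h3 : ∀ k ∈ Finset.Icc 1 p,
      (((Finset.univ.filter fun u : ZMod p => k ≤ levelCount q u).card * (3 * k ^ 2) : ℕ) : ℝ)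
        ≤ 6144000 * (p : ℝ) ^ 2 * (k : ℝ)⁻¹ := by
    intro k hk
    have hk0 : (0 : ℝ) < k := by exact_mod_cast (Finset.mem_Icc.1 hk).1
    have h4 : ((((Finset.univ.filter fun u : ZMod p => k ≤ levelCount q u).card * k ^ 3 : ℕ)) : ℝ)
        ≤ ((2048000 * p ^ 2 : ℕ) : ℝ) := by
      exact_mod_cast card_levelCount_ge_mul_cube_le hq hdeg k
    rw [← div_eq_mul_inv, le_div_iff₀ hk0]
    push_cast at h4 ⊢
    nlinarith
  calc ∑ u, (levelCount q u : ℝ) ^ 3 = ((∑ u, levelCount q u ^ 3 : ℕ) : ℝ) := by push_cast; rfl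
    _ ≤ ((∑ k ∈ Finset.Icc 1 p,
      (Finset.univ.filter fun u : ZMod p => k ≤ levelCount q u).card * (3 * k ^ 2) : ℕ) : ℝ) := by
        exact_mod_cast h2
    _ ≤ ∑ k ∈ Finset.Icc 1 p, 6144000 * (p : ℝ) ^ 2 * (k : ℝ)⁻¹ := by
        rw [Nat.cast_sum]
        exact Finset.sum_le_sum h3
    _ = 6144000 * (p : ℝ) ^ 2 * ((harmonic p : ℚ) : ℝ) := by
        rw [harmonic_eq_sum_Icc, ← Finset.mul_sum]
        push_cast
        rfl
    _ ≤ _ := by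
        gcongr
        exact harmonic_le_one_add_log p

theorem sum_levelCount_sq_eq (q : (ZMod p)[X]) :
    ∑ x ∈ Finset.univ.filter (fun x : ZMod p => x ≠ 0 ∧ x + 1 ≠ 0), levelCount q (q.eval x) ^ 2
      = ∑ u, levelCount q u ^ 3 := by
  rw [← Finset.sum_fiberwise _ (fun x => q.eval x)]
  refine Finset.sum_congr rfl fun u _ => ?_
  rw [Finset.filter_filter]
  have : ∀ x ∈ Finset.univ.filter (fun x : ZMod p => (x ≠ 0 ∧ x + 1 ≠ 0) ∧ q.eval x = u),
      levelCount q (q.eval x) ^ 2 = levelCount q u ^ 2 := by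
    intro x hx
    rw [(Finset.mem_filter.1 hx).2.2]
  rw [Finset.sum_congr rfl this, Finset.sum_const, smul_eq_mul, pow_succ' _ 2]
  congr 1
  rw [levelCount]
  congr 1
  ext x
  simp [and_assoc]

end LevelSets

/-! ### The group of `p`-th powers modulo `p ^ 2` and the Fermat quotient -/

section FermatQuotient

open Polynomial

/-- The polynomial `((X + 1) ^ p - X ^ p - 1) / p`, with its derivative and a degree bound. -/
theorem exists_fermatQuotient_polynomial (p : ℕ) (hp : p.Prime) :
    ∃ Q : ℤ[X], (X + 1) ^ p = X ^ p + 1 + (p : ℤ[X]) * Q ∧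
      derivative Q = (X + 1) ^ (p - 1) - X ^ (p - 1) ∧ Q.natDegree ≤ p := by
  obtain ⟨r, hr⟩ := exists_add_pow_prime_eq hp (X : ℤ[X]) 1
  have hp0 : (p : ℤ) ≠ 0 := by exact_mod_cast hp.ne_zero
  have hpX : (p : ℤ[X]) ≠ 0 := by exact_mod_cast hp.ne_zero
  have hQ : (X + 1 : ℤ[X]) ^ p = X ^ p + 1 + (p : ℤ[X]) * (X * r) := by
    rw [hr]
    ring
  refine ⟨X * r, hQ, ?_, ?_⟩
  · have h := congrArg derivative hQ
    simp only [derivative_pow, derivative_add, derivative_mul (f := (p : ℤ[X])), derivative_X,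
      derivative_one, derivative_natCast, map_natCast, add_zero, mul_one, zero_mul,
      zero_add] at h
    apply mul_left_cancel₀ hpX
    linear_combination -h
  · have h : C (p : ℤ) * (X * r) = (X + 1 : ℤ[X]) ^ p - (X ^ p + 1) := by
      rw [hQ]
      simp
    rw [← natDegree_C_mul hp0, h]
    refine (natDegree_sub_le _ _).trans (max_le ?_ ?_)
    · rw [← C_1, natDegree_pow, natDegree_X_add_C, mul_one]
    · refine (natDegree_add_le _ _).trans (max_le ?_ ?_)
      · exact natDegree_X_pow_le p
      · simp

/-- The nonzero `p`-th powers modulo `p ^ 2`. -/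
noncomputable def primePowers (p : ℕ) : Finset (ZMod (p ^ 2)) :=
  (Finset.Icc 1 (p - 1)).image fun n : ℕ => (n : ZMod (p ^ 2)) ^ p

theorem card_primePowers_le {p : ℕ} : (primePowers p).card ≤ p := by
  refine Finset.card_image_le.trans ?_
  rw [Nat.card_Icc]
  omega

theorem diffCount_primePowers_le {p : ℕ} (d : ZMod (p ^ 2)) : diffCount (primePowers p) d ≤ p := by
  rw [diffCount_def]
  exact (Finset.card_filter_le _ _).trans card_primePowers_le

variable {p : ℕ} [Fact p.Prime]

theorem intCast_pow_prime_eq {a b : ℤ} (h : (a : ZMod p) = b) :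
    ((a : ZMod (p ^ 2)) ^ p) = (b : ZMod (p ^ 2)) ^ p := by
  have h1 : (p : ℤ) ∣ a - b := by
    rw [← ZMod.intCast_zmod_eq_zero_iff_dvd _ p]
    push_cast
    rw [h, sub_self]
  have h2 := dvd_sub_pow_of_dvd_sub h1 1
  rw [pow_one] at h2
  have h3 : (((a ^ p - b ^ p : ℤ)) : ZMod (p ^ 2)) = 0 := by
    rw [ZMod.intCast_zmod_eq_zero_iff_dvd]
    exact_mod_cast h2
  push_cast at h3
  exact sub_eq_zero.1 h3

/-- Reduction from `ZMod (p ^ 2)` to `ZMod p`. -/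
noncomputable def reduction (p : ℕ) : ZMod (p ^ 2) →+* ZMod p :=
  ZMod.castHom (dvd_pow_self p two_ne_zero) (ZMod p)

theorem reduction_pow (a : ℤ) : reduction p ((a : ZMod (p ^ 2)) ^ p) = (a : ZMod p) := by
  rw [map_pow, map_intCast, ZMod.pow_card]

theorem mem_primePowers {x : ZMod (p ^ 2)} :
    x ∈ primePowers p ↔ ∃ a : ℤ, (a : ZMod p) ≠ 0 ∧ x = (a : ZMod (p ^ 2)) ^ p := by
  have hp1 : 1 ≤ p := (Fact.out : p.Prime).one_le
  simp only [primePowers, Finset.mem_image, Finset.mem_Icc]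
  constructor
  · rintro ⟨n, hn, rfl⟩
    refine ⟨n, ?_, by simp⟩
    rw [Int.cast_natCast, Ne, ZMod.natCast_eq_zero_iff]
    intro h
    have := Nat.le_of_dvd (by omega) h
    omega
  · rintro ⟨a, ha, rfl⟩
    refine ⟨(a : ZMod p).val, ⟨?_, ?_⟩, ?_⟩
    · exact Nat.one_le_iff_ne_zero.2 fun h => ha ((ZMod.val_eq_zero _).1 h)
    · have := ZMod.val_lt (a : ZMod p)
      omega
    · rw [← Int.cast_natCast]
      exact intCast_pow_prime_eq (by simp)

theorem reduction_injOn_primePowers : Set.InjOn (reduction p) (primePowers p : Set _) := by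
  intro x hx y hy h
  obtain ⟨a, -, rfl⟩ := mem_primePowers.1 hx
  obtain ⟨b, -, rfl⟩ := mem_primePowers.1 hy
  rw [reduction_pow, reduction_pow] at h
  exact intCast_pow_prime_eq h

theorem mul_mem_primePowers : ∀ x ∈ primePowers p, ∀ y ∈ primePowers p, x * y ∈ primePowers p := by
  intro x hx y hy
  obtain ⟨a, ha, rfl⟩ := mem_primePowers.1 hx
  obtain ⟨b, hb, rfl⟩ := mem_primePowers.1 hy
  refine mem_primePowers.2 ⟨a * b, ?_, ?_⟩
  · push_cast
    exact mul_ne_zero ha hb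
  · push_cast
    rw [mul_pow]

theorem isUnit_intCast_of_ne_zero {a : ℤ} (ha : (a : ZMod p) ≠ 0) :
    IsUnit (a : ZMod (p ^ 2)) := by
  rw [ZMod.coe_int_isUnit_iff_isCoprime]
  have h : ¬ (p : ℤ) ∣ a := fun h => ha ((ZMod.intCast_zmod_eq_zero_iff_dvd _ p).2 h)
  have hprime : Prime (p : ℤ) := Nat.prime_iff_prime_int.1 Fact.out
  push_cast
  exact IsCoprime.pow_left ((Prime.coprime_iff_not_dvd hprime).2 h)

theorem isUnit_of_mem_primePowers : ∀ x ∈ primePowers p, IsUnit x := by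
  intro x hx
  obtain ⟨a, ha, rfl⟩ := mem_primePowers.1 hx
  exact (isUnit_intCast_of_ne_zero ha).pow p

theorem diffCount_mul_left {R : Type*} [CommRing R] (H : Finset R)
    (hmul : ∀ x ∈ H, ∀ y ∈ H, x * y ∈ H) (hunit : ∀ x ∈ H, IsUnit x) {h : R} (hh : h ∈ H) (d : R) :
    diffCount H (h * d) = diffCount H d := by
  classical
  have hiff : ∀ x, h * x ∈ H ↔ x ∈ H := by
    intro x
    refine ⟨fun hx => ?_, hmul h hh x⟩
    have h1 := sum_mul_left_of_mul_closed H hmul hunit hh (fun y => if y = h * x then 1 else 0)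
    rw [Finset.sum_ite_eq', if_pos hx] at h1
    obtain ⟨y, hy, hyx⟩ := Finset.exists_ne_zero_of_sum_ne_zero (h1.trans_ne one_ne_zero)
    rw [ite_ne_right_iff] at hyx
    rwa [← (hunit h hh).mul_left_cancel hyx.1]
  rw [diffCount_def, diffCount_def, Finset.card_filter, Finset.card_filter,
    ← sum_mul_left_of_mul_closed H hmul hunit hh]
  refine Finset.sum_congr rfl fun x _ => ?_
  rw [← mul_sub]
  simp only [hiff]

theorem sum_diffCount_cube_eq_card_mul {R : Type*} [CommRing R] [Fintype R] (H : Finset R)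
    (hmul : ∀ x ∈ H, ∀ y ∈ H, x * y ∈ H) (hunit : ∀ x ∈ H, IsUnit x) :
    ∑ d : R, (diffCount H d : ℝ) ^ 3 = H.card * ∑ y ∈ H, (diffCount H (y - 1) : ℝ) ^ 2 := by
  rw [sum_diffCount_cube, Finset.sum_comm, ← nsmul_eq_mul, ← Finset.sum_const]
  refine Finset.sum_congr rfl fun z hz => ?_
  rw [← sum_mul_left_of_mul_closed H hmul hunit hz]
  refine Finset.sum_congr rfl fun y _ => ?_
  rw [← diffCount_mul_left H hmul hunit hz (y - 1), mul_sub, mul_one]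

theorem eval_fermatQuotient_eq {Q : ℤ[X]} (hQ : (X + 1) ^ p = X ^ p + 1 + (p : ℤ[X]) * Q) {s t : ℤ}
    (h : ((s : ZMod (p ^ 2)) + 1) ^ p - (s : ZMod (p ^ 2)) ^ p
      = ((t : ZMod (p ^ 2)) + 1) ^ p - (t : ZMod (p ^ 2)) ^ p) :
    (Q.map (Int.castRingHom (ZMod p))).eval (s : ZMod p)
      = (Q.map (Int.castRingHom (ZMod p))).eval (t : ZMod p) := by
  have hev : ∀ n : ℤ, (n + 1) ^ p = n ^ p + 1 + p * Q.eval n := fun n => by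
    simpa using congrArg (eval n) hQ
  have h1 : ((p * (Q.eval s - Q.eval t) : ℤ) : ZMod (p ^ 2)) = 0 := by
    have h2 : (p * (Q.eval s - Q.eval t) : ℤ)
        = ((s + 1) ^ p - s ^ p) - ((t + 1) ^ p - t ^ p) := by
      rw [hev, hev]
      ring
    rw [h2]
    push_cast
    rw [h, sub_self]
  rw [ZMod.intCast_zmod_eq_zero_iff_dvd] at h1
  push_cast at h1
  rw [sq] at h1
  have h3 := (mul_dvd_mul_iff_left
    (by exact_mod_cast (Fact.out : p.Prime).ne_zero : (p : ℤ) ≠ 0)).1 h1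
  have h4 := (ZMod.intCast_zmod_eq_zero_iff_dvd _ p).2 h3
  push_cast at h4
  have h5 : ∀ n : ℤ, (Q.map (Int.castRingHom (ZMod p))).eval (n : ZMod p)
      = ((Q.eval n : ℤ) : ZMod p) := fun n => by
    simp
  rw [h5, h5]
  exact sub_eq_zero.1 h4

/-- If `k ^ p - l ^ p = n ^ p - 1` mod `p ^ 2`, then `k - l = n - 1` mod `p`. Scaling by `x = 1 / (n
- 1)` turns `k * x` into `l * x + 1` and `n * x` into `x + 1`, so `(l * x + 1) ^ p - (l * x) ^ p =
(x + 1) ^ p - x ^ p`, that is, `q (l * x) = q x`. The map `l ^ p ↦ l * x` is injective. -/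
theorem diffCount_primePowers_sub_one_le {Q : ℤ[X]}
    (hQ : (X + 1) ^ p = X ^ p + 1 + (p : ℤ[X]) * Q) {n x : ℤ}
    (hx : ((n : ZMod p) - 1) * x = 1) :
    diffCount (primePowers p) ((n : ZMod (p ^ 2)) ^ p - 1)
      ≤ levelCount (Q.map (Int.castRingHom (ZMod p)))
        ((Q.map (Int.castRingHom (ZMod p))).eval (x : ZMod p)) := by
  set d := (n : ZMod (p ^ 2)) ^ p - 1 with hd
  have hx0 : (x : ZMod p) ≠ 0 := right_ne_zero_of_mul_eq_one hx
  have hrd : reduction p d = (n : ZMod p) - 1 := by rw [hd, map_sub, reduction_pow, map_one]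
  have hnx : ((n : ZMod (p ^ 2)) * x) ^ p = ((x : ZMod (p ^ 2)) + 1) ^ p := by
    have := intCast_pow_prime_eq (a := n * x) (b := x + 1)
      (by push_cast; linear_combination hx)
    exact_mod_cast this
  rw [diffCount_def, levelCount]
  refine Finset.card_le_card_of_injOn (fun y => reduction p (y - d) * (x : ZMod p)) ?_ ?_
  · intro y hy
    obtain ⟨hyH, hydH⟩ := Finset.mem_filter.1 hy
    obtain ⟨k, hk, hyk⟩ := mem_primePowers.1 hyH
    obtain ⟨l, hl, hyl⟩ := mem_primePowers.1 hydH
    have hkl : (k : ZMod p) - l = (n : ZMod p) - 1 := by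
      rw [← hrd, ← reduction_pow k, ← reduction_pow l, ← hyk, ← hyl, ← map_sub, sub_sub_cancel]
    have hkx : (l : ZMod p) * x + 1 = k * x := by linear_combination -x * hkl - hx
    have hkx' : ((l : ZMod (p ^ 2)) * x + 1) ^ p = ((k : ZMod (p ^ 2)) * x) ^ p := by
      have := intCast_pow_prime_eq (a := l * x + 1) (b := k * x) (by push_cast; exact hkx)
      exact_mod_cast this
    have hq := eval_fermatQuotient_eq hQ (s := l * x) (t := x) (by
      push_cast
      rw [hkx', ← hnx, mul_pow, mul_pow, mul_pow, ← hyk, ← hyl, hd]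
      ring)
    rw [Finset.mem_coe, Finset.mem_filter]
    refine ⟨Finset.mem_univ _, ?_, ?_, ?_⟩ <;> beta_reduce
    · rw [hyl, reduction_pow]
      exact mul_ne_zero hl hx0
    · rw [hyl, reduction_pow, hkx]
      exact mul_ne_zero hk hx0
    · rw [hyl, reduction_pow]
      exact_mod_cast hq
  · intro y hy z hz hyz
    have h1 := mul_right_cancel₀ hx0 hyz
    rw [map_sub _ y, map_sub _ z, sub_left_inj] at h1
    exact reduction_injOn_primePowers (Finset.mem_filter.1 hy).1 (Finset.mem_filter.1 hz).1 h1

theorem sum_diffCount_primePowers_sub_one_sq_le {Q : ℤ[X]}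
    (hQ : (X + 1) ^ p = X ^ p + 1 + (p : ℤ[X]) * Q) :
    ∑ y ∈ primePowers p, diffCount (primePowers p) (y - 1) ^ 2
      ≤ p ^ 2 + ∑ u, levelCount (Q.map (Int.castRingHom (ZMod p))) u ^ 3 := by
  classical
  set q := Q.map (Int.castRingHom (ZMod p)) with hq
  have h1 : (1 : ZMod (p ^ 2)) ∈ primePowers p := mem_primePowers.2 ⟨1, by simp, by simp⟩
  have hne : ∀ y ∈ (primePowers p).erase 1, reduction p y - 1 ≠ 0 := by
    intro y hy h
    obtain ⟨hy1, hyH⟩ := Finset.mem_erase.1 hy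
    refine hy1 (reduction_injOn_primePowers hyH h1 ?_)
    rw [map_one]
    exact sub_eq_zero.1 h
  rw [← Finset.add_sum_erase _ _ h1, ← sum_levelCount_sq_eq]
  -- The term `y = 1` is the zero difference and costs at most `p ^ 2`; the other `y` have distinct
  -- points `x = 1 / (y - 1)` mod `p`.
  refine add_le_add (Nat.pow_le_pow_left (diffCount_primePowers_le _) 2) ?_
  have hinj : Set.InjOn (fun y => (reduction p y - 1)⁻¹) ((primePowers p).erase 1 : Set _) := by
    intro y hy z hz hyz
    refine reduction_injOn_primePowers (Finset.mem_of_mem_erase hy) (Finset.mem_of_mem_erase hz) ?_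
    exact sub_left_injective (inv_injective hyz)
  calc _ ≤ ∑ y ∈ (primePowers p).erase 1, levelCount q (q.eval (reduction p y - 1)⁻¹) ^ 2 := by
        refine Finset.sum_le_sum fun y hy => Nat.pow_le_pow_left ?_ 2
        have hy0 := hne y hy
        obtain ⟨n, -, rfl⟩ := mem_primePowers.1 (Finset.mem_of_mem_erase hy)
        rw [reduction_pow] at hy0 ⊢
        obtain ⟨x, hx⟩ := ZMod.intCast_surjective ((n : ZMod p) - 1)⁻¹
        rw [← hx]
        exact diffCount_primePowers_sub_one_le hQ (by rw [hx, mul_inv_cancel₀ hy0])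
    _ = ∑ x ∈ ((primePowers p).erase 1).image (fun y => (reduction p y - 1)⁻¹),
          levelCount q (q.eval x) ^ 2 := 
        (Finset.sum_image (f := fun x => levelCount q (q.eval x) ^ 2) hinj).symm
    _ ≤ _ := by
        refine Finset.sum_le_sum_of_subset fun x hx => ?_
        obtain ⟨y, hy, rfl⟩ := Finset.mem_image.1 hx
        have hy0 := hne y hy
        refine Finset.mem_filter.2 ⟨Finset.mem_univ _, inv_ne_zero hy0, fun h => ?_⟩
        obtain ⟨n, hn, rfl⟩ := mem_primePowers.1 (Finset.mem_of_mem_erase hy)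
        rw [reduction_pow] at h hy0
        apply hn
        have h2 : ((n : ZMod p) - 1) * (((n : ZMod p) - 1)⁻¹ + 1) = 0 := by rw [h, mul_zero]
        rw [mul_add, mul_inv_cancel₀ hy0] at h2
        linear_combination h2

theorem sum_diffCount_primePowers_cube_le :
    ∑ d, (diffCount (primePowers p) d : ℝ) ^ 3
      ≤ p * ((p : ℝ) ^ 2 + 6144000 * (p : ℝ) ^ 2 * (1 + Real.log p)) := by
  obtain ⟨Q, hQ, hQ', hdeg⟩ := exists_fermatQuotient_polynomial p Fact.out
  rw [sum_diffCount_cube_eq_card_mul _ mul_mem_primePowers isUnit_of_mem_primePowers]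
  have hq : X * derivative (Q.map (Int.castRingHom (ZMod p))) = 1 - (X + 1) ^ (p - 1) := by
    apply X_mul_derivative_of_derivative_eq
    rw [derivative_map, hQ']
    simp
  have h1 := sum_levelCount_cube_le hq (natDegree_map_le.trans hdeg)
  have h2 : ((∑ y ∈ primePowers p, diffCount (primePowers p) (y - 1) ^ 2 : ℕ) : ℝ)
      ≤ ((p ^ 2 + ∑ u, levelCount (Q.map (Int.castRingHom (ZMod p))) u ^ 3 : ℕ) : ℝ) := by
    exact_mod_cast sum_diffCount_primePowers_sub_one_sq_le hQ
  push_cast at h2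
  have h3 : ((primePowers p).card : ℝ) ≤ p := by exact_mod_cast card_primePowers_le
  gcongr
  linarith

end FermatQuotient

/-! ### Application to Heilbronn's sum -/

theorem AddChar.IsPrimitive.mulShift_of_isUnit {R M : Type*} [CommRing R] [CommMonoid M]
    {ψ : AddChar R M} (hψ : ψ.IsPrimitive) {a : R} (ha : IsUnit a) :
    (ψ.mulShift a).IsPrimitive := by
  intro b hb
  rw [AddChar.mulShift_mulShift]
  exact hψ fun h => hb ((ha.mul_right_eq_zero).1 h)

theorem heilbronnSum_eq (p : ℕ) [NeZero (p ^ 2)] (a : ℤ) :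
    heilbronnSum p a = ∑ n ∈ Finset.Icc 1 p,
      ZMod.stdAddChar ((a : ZMod (p ^ 2)) * (n : ZMod (p ^ 2)) ^ p) := by
  refine Finset.sum_congr rfl fun n _ => ?_
  have h := ZMod.stdAddChar_coe (N := p ^ 2) (a * (n : ℤ) ^ p)
  push_cast at h
  rw [h]
  congr 1
  ring

theorem norm_sum_primePowers_pow_six_le {p : ℕ} [Fact p.Prime] [NeZero (p ^ 2)] {a : ℤ}
    (ha : (a : ZMod p) ≠ 0) :
    ‖∑ h ∈ primePowers p, (ZMod.stdAddChar (N := p ^ 2)).mulShift (a : ZMod (p ^ 2)) h‖ ^ 6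
      ≤ (p : ℝ) ^ 5 * (1 + 6144000 * (1 + Real.log p)) := by
  refine (norm_charSum_pow_six_le _ ((ZMod.isPrimitive_stdAddChar (p ^ 2)).mulShift_of_isUnit
    (isUnit_intCast_of_ne_zero ha)) _ mul_mem_primePowers isUnit_of_mem_primePowers).trans ?_
  rw [ZMod.card]
  calc _ ≤ ((p ^ 2 : ℕ) : ℝ)
        * (p * ((p : ℝ) ^ 2 + 6144000 * (p : ℝ) ^ 2 * (1 + Real.log p))) := by
        gcongr
        exact sum_diffCount_primePowers_cube_le
    _ = _ := by
        push_cast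
        ring

theorem norm_heilbronnSum_le {p : ℕ} [Fact p.Prime] [NeZero (p ^ 2)] (a : ℤ) :
    ‖heilbronnSum p a‖ ≤ 1 +
      ‖∑ h ∈ primePowers p, (ZMod.stdAddChar (N := p ^ 2)).mulShift (a : ZMod (p ^ 2)) h‖ := by
  obtain ⟨m, rfl⟩ : ∃ m, p = m + 1 := Nat.exists_eq_succ_of_ne_zero (Fact.out : p.Prime).ne_zero
  have hinj : Set.InjOn (fun n : ℕ => (n : ZMod ((m + 1) ^ 2)) ^ (m + 1))
      (Finset.Icc 1 m : Set ℕ) := by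
    intro n hn k hk h
    have h1 := congrArg (reduction (m + 1)) h
    have h2 : ∀ n : ℕ, reduction (m + 1) ((n : ZMod ((m + 1) ^ 2)) ^ (m + 1)) = n := fun n => by
      simp [ZMod.pow_card]
    simp only [h2] at h1
    rw [Finset.coe_Icc, Set.mem_Icc] at hn hk
    rw [ZMod.natCast_eq_natCast_iff'] at h1
    rwa [Nat.mod_eq_of_lt (by omega), Nat.mod_eq_of_lt (by omega)] at h1
  rw [heilbronnSum_eq, Finset.sum_Icc_succ_top (by omega), add_comm, primePowers,
    Nat.add_sub_cancel, Finset.sum_image hinj]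
  refine (norm_add_le _ _).trans (add_le_add ?_ (le_of_eq ?_))
  · rw [AddChar.norm_apply]
  · rfl

theorem heilbronnSum_pow_six_le {p : ℕ} (hp : p.Prime) {a : ℤ} (ha : ¬ (p : ℤ) ∣ a) :
    ‖heilbronnSum p a‖ ^ 6 ≤ 1000000000 * (p : ℝ) ^ 5 * Real.log p := by
  have := Fact.mk hp
  have : NeZero (p ^ 2) := ⟨pow_ne_zero 2 hp.ne_zero⟩
  have ha' : (a : ZMod p) ≠ 0 := fun h => ha ((ZMod.intCast_zmod_eq_zero_iff_dvd a p).1 h)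
  have h1 := norm_sum_primePowers_pow_six_le ha'
  have h2 := norm_heilbronnSum_le (p := p) a
  set s := ‖∑ h ∈ primePowers p, (ZMod.stdAddChar (N := p ^ 2)).mulShift (a : ZMod (p ^ 2)) h‖
  have hp2 : (2 : ℝ) ≤ p := by exact_mod_cast hp.two_le
  have hlog : 1 ≤ 2 * Real.log p := by
    have := Real.log_le_log (by norm_num) hp2
    have := Real.log_two_gt_d9
    linarith
  have hp5 : 1 ≤ (p : ℝ) ^ 5 := one_le_pow₀ (by linarith)
  calc ‖heilbronnSum p a‖ ^ 6 ≤ (1 + s) ^ 6 := by gcongr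
    _ ≤ 2 ^ (6 - 1) * (1 ^ 6 + s ^ 6) := add_pow_le zero_le_one (norm_nonneg _) 6
    _ ≤ 2 ^ (6 - 1) * ((p : ℝ) ^ 5 * 1 + (p : ℝ) ^ 5 * (1 + 6144000 * (1 + Real.log p))) := by
        gcongr
        linarith
    _ = (p : ℝ) ^ 5 * (32 * (2 + 6144000 * (1 + Real.log p))) := by ring
    -- Since `1 ≤ 2 * log p`, the bracket is at most `32 * (4 + 3 * 6144000) * log p`, which is
    -- below `10 ^ 9 * log p`.
    _ ≤ (p : ℝ) ^ 5 * (1000000000 * Real.log p) :=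
        mul_le_mul_of_nonneg_left (by linarith) (by positivity)
    _ = _ := by ring

theorem theorem5p1 :
    ∃ C : ℝ, 0 < C ∧ ∀ (p : ℕ) (a : ℤ), p.Prime → ¬ ((p : ℤ) ∣ a) →
      ‖heilbronnSum p a‖
        ≤ C * (p : ℝ) ^ ((5 : ℝ) / 6) * (Real.log (p : ℝ)) ^ ((1 : ℝ) / 6) := by
  refine ⟨(1000000000 : ℝ) ^ ((1 : ℝ) / 6), by positivity, fun p a hp ha => ?_⟩
  have hlog : 0 ≤ Real.log p := Real.log_natCast_nonneg p
  refine le_of_pow_le_pow_left₀ (n := 6) (by norm_num) (by positivity) ?_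
  refine (heilbronnSum_pow_six_le hp ha).trans (le_of_eq ?_)
  rw [mul_pow, mul_pow, ← Real.rpow_mul_natCast (by norm_num), ← Real.rpow_mul_natCast (by simp),
    ← Real.rpow_mul_natCast hlog, ← Real.rpow_natCast (p : ℝ) 5]
  norm_num
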